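/- Let $l_1,\ldots,l_m$ be positive integers, $\overline{l}=(l_1,\ldots,l_m)$, $L:=l_1+\cdots+l_m$, and let $\overline{\alpha}=(\alpha_1,\ldots,\alpha_m)$ be distinct variables. Let $\mathcal{V}=\mathcal{V}(\overline{\alpha})$ be the $L\times(L+1)$ matrix over $\mathbb{Z}[\overline{\alpha}]$ whose rows are indexed by the pairs $(j,k)$ with $1\le j\le m$ and $1\le k\le l_j$, in lexicographic order, whose columns are indexed by $h=0,1,\ldots,L$, and whose entry in row $(j,k)$ and column $h$ is $\binom{L+k}{h}\alpha_j^{L-h}$. For $i=0,\ldots,L$ let $\mathcal{V}[i]$ be the $L\times L$ minor of $\mathcal{V}$ obtained by deleting column $i$. Put $$T(\overline{l},\overline{\alpha}):=\alpha_1^{\binom{l_1}{2}}\cdots\alpha_m^{\binom{l_m}{2}}\prod_{1\le i<j\le m}(\alpha_i-\alpha_j)^{\min\{l_i^2,\,l_j^2\}}.$$ Then $T(\overline{l},\overline{\alpha})$ is a non-zero polynomial which divides all the minors $\mathcal{V}[0],\ldots,\mathcal{V}[L]$ in $\mathbb{Z}[\overline{\alpha}]$, and there exist non-zero polynomials $B_{\overline{l},j}(t,\overline{\alpha})\in\mathbb{Q}[t,\overline{\alpha}]$,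 $j=0,1,\ldots,m$, and remainders $S_{\overline{l},j}(t,\overline{\alpha})\in\mathbb{Q}[\overline{\alpha}][[t]]$, $j=1,\ldots,m$, such that $$B_{\overline{l},0}(t,\overline{\alpha})\,e^{\alpha_j t}-B_{\overline{l},j}(t,\overline{\alpha})=S_{\overline{l},j}(t,\overline{\alpha}),\qquad j=1,\ldots,m,$$ where $e^{\alpha_j t}=\sum_{n\ge0}\frac{\alpha_j^n}{n!}t^n$ and $$\deg_t B_{\overline{l},j}(t,\overline{\alpha})\le L\quad(j=0,\ldots,m),\qquad L+l_j+1\le\operatorname*{ord}_{t=0}S_{\overline{l},j}(t,\overline{\alpha})<\infty\quad(j=1,\ldots,m).$$ Moreover, $$B_{\overline{l},0}(t,\overline{\alpha})=\sum_{i=0}^{L}\frac{L!}{i!}\,\tau_i(\overline{l},\overline{\alpha})\,t^i,\qquad \tau_i(\overline{l},\overline{\alpha})=\frac{(-1)^i\,\mathcal{V}[i]}{T(\overline{l},\overline{\alpha})}\in\mathbb{Z}[\overline{\alpha}]\quad(i=0,\ldots,L).$$ -/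

import Mathlib

namespace HermiteThue

/-- `L = l₁ + ⋯ + l_m`. -/
abbrev total {m : ℕ} (l : Fin m → ℕ) : ℕ := ∑ j, l j

/-- The `L × (L + 1)` matrix `V(α)` over `ℤ[α₁, …, α_m]`. It consists of `m` blocks of rows stacked
from top to bottom, the block `j` having `l j` rows; `finSigmaFinEquiv` numbers the rows
`(j, k)`, `k < l j`, lexicographically. The entry in the row `(j, k)` and the column
`h = 0, …, L` is `binom (L + k + 1) h * α_j ^ (L - h)`. -/
noncomputable def matV {m : ℕ} (l : Fin m → ℕ) :
    Matrix (Fin (total l)) (Fin (total l + 1)) (MvPolynomial (Fin m) ℤ) :=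
  Matrix.of fun r h =>
    (((total l + ((finSigmaFinEquiv.symm r).2 : ℕ) + 1).choose (h : ℕ) : ℕ) :
        MvPolynomial (Fin m) ℤ) *
      MvPolynomial.X (finSigmaFinEquiv.symm r).1 ^ (total l - (h : ℕ))

/-- The minor `V[i]`: the determinant of the matrix left after deleting the column `i`
(columns are numbered from `0`). -/
noncomputable def minorV {m : ℕ} (l : Fin m → ℕ) (i : Fin (total l + 1)) :
    MvPolynomial (Fin m) ℤ :=
  ((matV l).submatrix id i.succAbove).det

/-- `T(l, α) = ∏_j α_j ^ binom (l_j) 2 * ∏_{i < j} (α_i - α_j) ^ min (l_i ^ 2) (l_j ^ 2)`. -/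
noncomputable def factorT {m : ℕ} (l : Fin m → ℕ) : MvPolynomial (Fin m) ℤ :=
  (∏ j, MvPolynomial.X j ^ (l j).choose 2) *
    ∏ i, ∏ j ∈ Finset.Ioi i,
      (MvPolynomial.X i - MvPolynomial.X j) ^ min (l i ^ 2) (l j ^ 2)

/-- The formal power series `e^{α_j t}` in `t` with coefficients in `ℚ[α₁, …, α_m]`. -/
noncomputable def expSeries {m : ℕ} (j : Fin m) : PowerSeries (MvPolynomial (Fin m) ℚ) :=
  PowerSeries.rescale (MvPolynomial.X j) (PowerSeries.exp (MvPolynomial (Fin m) ℚ))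

end HermiteThue

/-!
Let `g_n(X) = (binom n h * X ^ (L - h))_h`, so that the rows of the block `j` of `matV` are
`g_n(X j)` for `L < n ≤ L + l j`. Vanishing of the coefficient of `t ^ n` in `B₀ e^{X_j t}`, where
`B₀ = ∑ L!/i! τ_i t ^ i`, amounts to orthogonality of `τ` to `g_n(X j)`. By Cramer's rule the signed
maximal minors of `matV` are orthogonal to all its rows, and so are their quotients by the common
factor `factorT l`. The polynomials `B_j` are the truncations of `B₀ e^{X_j t}`, and the remainders
do not vanish because the exponential is not a rational function (`mul_rescale_exp_ne`).

Two facts about the minors remain.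

* *The common factor.* The Euler derivation `θ = X i ∂/∂X i` satisfies
  `θ g_n = (L - n) g_n + n g_{n-1}`. Hence `θ` turns a determinant with rows `g_n(X r)` into a
  combination of determinants of this kind, where at most one upper index `n` of the block `i` is
  lowered by one. Such a determinant vanishes modulo `X i - X j` when a row `g_n` occurs twice in the
  blocks `i` and `j` together. If `l i ≤ l j`, the upper indices `L + 1, …, L + l i` of the block `i`
  all have to move to distinct values at most `L`, which takes at least `l i ^ 2` steps; as `θ`
  lowers the order of vanishing along `X i = X j` by at most one, `(X i - X j) ^ (l i ^ 2)` divides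
  the minor (`pow_dvd_det_binomMatrix`). The powers of the `X j` are visible in the Leibniz formula.
* *Non-vanishing.* Under `X j ↦ X ^ j` the lowest coefficient of the minor without the last
  column is the determinant of a block diagonal matrix of binomial coefficients, by the equality case
  of the rearrangement inequality (`det_ne_zero_of_blockDiagonal`). A polynomial with too many zeros
  shows that this determinant is not zero (`det_blockDiagonal_choose_ne_zero`).
-/

namespace HermiteThue
open MvPolynomial

/-! ### Sums of distinct numbers and derivatives of determinants -/

theorem card_choose_two_le_sum (s : Finset ℕ) : s.card.choose 2 ≤ ∑ x ∈ s, x := by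
  induction s using Finset.induction_on_max with
  | empty => simp
  | insert a s ha ih =>
    have hn : a ∉ s := fun h => lt_irrefl _ (ha a h)
    have hc : s.card ≤ a := by
      simpa using Finset.card_le_card (fun x hx => Finset.mem_range.2 (ha x hx) : s ⊆ Finset.range a)
    rw [Finset.card_insert_of_notMem hn, Finset.sum_insert hn, Nat.choose_succ_succ' _ 1]
    simp only [Nat.choose_one_right, Nat.reduceAdd]
    omega

theorem card_choose_two_le_sum_of_injOn {ι : Type*} (s : Finset ι) (f : ι → ℕ)
    (hf : Set.InjOn f s) : s.card.choose 2 ≤ ∑ x ∈ s, f x := by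
  classical
  have := card_choose_two_le_sum (s.image f)
  rwa [Finset.card_image_of_injOn hf, Finset.sum_image hf] at this

theorem derivation_prod {R A ι : Type*} [CommRing R] [CommRing A] [Algebra R A] [DecidableEq ι]
    (D : Derivation R A A) (s : Finset ι) (f : ι → A) :
    D (∏ i ∈ s, f i) = ∑ i ∈ s, ∏ k ∈ s, Function.update f i (D (f i)) k := by
  induction s using Finset.induction_on with
  | empty => simp
  | insert a s ha ih =>
    have h1 : ∏ k ∈ s, Function.update f a (D (f a)) k = ∏ k ∈ s, f k :=
      Finset.prod_congr rfl fun k hk => Function.update_of_ne (ne_of_mem_of_not_mem hk ha) _ _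
    have h2 : ∀ i ∈ s, ∏ k ∈ insert a s, Function.update f i (D (f i)) k
        = f a * ∏ k ∈ s, Function.update f i (D (f i)) k := fun i hi => by
      rw [Finset.prod_insert ha, Function.update_of_ne (ne_of_mem_of_not_mem hi ha).symm]
    rw [Finset.prod_insert ha, D.leibniz, ih, Finset.sum_insert ha, Finset.sum_congr rfl h2,
      ← Finset.mul_sum, Finset.prod_insert ha, h1]
    simp only [smul_eq_mul, Function.update_self]
    ring

/-- A derivation acts on a determinant one row at a time. -/
theorem derivation_det {R A ι : Type*} [CommRing R] [CommRing A] [Algebra R A] [DecidableEq ι]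
    [Fintype ι] (D : Derivation R A A) (M : Matrix ι ι A) :
    D M.det = ∑ r, (M.updateRow r fun c => D (M r c)).det := by
  have h : ∀ N : Matrix ι ι A, N.det = ∑ σ : Equiv.Perm ι, σ.sign • ∏ i, N i (σ i) := fun N => by
    rw [← Matrix.det_transpose, Matrix.det_apply]; rfl
  simp_rw [h]
  rw [Finset.sum_comm, map_sum]
  refine Finset.sum_congr rfl fun σ _ => ?_
  rw [← Finset.smul_sum, Units.smul_def, Units.smul_def, map_zsmul, derivation_prod]
  congr 1
  refine Finset.sum_congr rfl fun r _ => Finset.prod_congr rfl fun k _ => ?_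
  by_cases hk : k = r
  · subst hk; simp
  · simp [hk]

/-! ### The multiplicity of `X i - X j` in determinants of binomial rows -/

variable {σ : Type*}

theorem prime_X_sub_X {i j : σ} (h : i ≠ j) : Prime (X i - X j : MvPolynomial σ ℤ) := by
  classical
  have hs : (X i - X j : MvPolynomial σ ℤ).coeff (Finsupp.single i 1) = 1 := by
    simp [coeff_X, Finsupp.single_left_inj, h.symm]
  refine (irreducible_of_totalDegree_eq_one ?_ ?_).prime
  · refine le_antisymm ?_ ?_
    · refine (totalDegree_sub _ _).trans ?_
      simp
    · have := le_totalDegree (p := (X i - X j : MvPolynomial σ ℤ)) (s := Finsupp.single i 1)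
        (by rw [mem_support_iff, hs]; exact one_ne_zero)
      simpa using this
  · intro x hx
    exact isUnit_of_dvd_one (hs ▸ hx (Finsupp.single i 1))

theorem not_dvd_of_eval {p q : MvPolynomial σ ℤ} (x : σ → ℤ) (hp : eval x p = 0)
    (hq : eval x q ≠ 0) : ¬ p ∣ q := by
  rintro ⟨u, rfl⟩
  simp [hp] at hq

theorem X_sub_X_not_dvd_X (i j k : σ) : ¬ (X i - X j : MvPolynomial σ ℤ) ∣ X k :=
  not_dvd_of_eval (fun _ => 1) (by simp) (by simp)

/-- The multiplicity of `X i - X j` in `D` can be read off from `X i * ∂D/∂X i`, as this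
operator lowers it by exactly one in characteristic zero. -/
theorem pow_succ_dvd_of_pderiv {i j : σ} (hij : i ≠ j) {s : ℕ} (hs : s ≠ 0)
    {D : MvPolynomial σ ℤ} (h : (X i - X j) ^ s ∣ D)
    (h' : (X i - X j) ^ s ∣ X i * pderiv i D) : (X i - X j) ^ (s + 1) ∣ D := by
  have hp := prime_X_sub_X hij
  have h1 := hp.pow_dvd_of_dvd_mul_left s (X_sub_X_not_dvd_X i j i) h'
  obtain ⟨u, rfl⟩ := h
  obtain ⟨s, rfl⟩ := Nat.exists_eq_succ_of_ne_zero hs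
  have hd : pderiv i (X i - X j : MvPolynomial σ ℤ) = 1 := by
    rw [map_sub, pderiv_X_self, pderiv_X_of_ne hij.symm, sub_zero]
  rw [pderiv_mul, pderiv_pow, hd] at h1
  have h2 := (dvd_add_left (Dvd.intro _ rfl)).1 h1
  have h3 : (X i - X j : MvPolynomial σ ℤ) ^ s * (X i - X j) ∣
      (X i - X j) ^ s * (((s + 1 : ℕ) : MvPolynomial σ ℤ) * u) := by
    rw [← pow_succ]
    convert h2 using 1
    rw [Nat.succ_sub_one]
    ring
  have h4 := (mul_dvd_mul_iff_left (pow_ne_zero s hp.ne_zero)).1 h3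
  have h5 : ¬ (X i - X j : MvPolynomial σ ℤ) ∣ ((s + 1 : ℕ) : MvPolynomial σ ℤ) :=
    not_dvd_of_eval (fun _ => 1) (by simp) (by rw [map_natCast]; exact_mod_cast s.succ_ne_zero)
  rw [pow_succ]
  exact mul_dvd_mul_left _ ((hp.dvd_or_dvd h4).resolve_left h5)

/-- The matrix with entries `binom (n r) (e c) * X_{b r} ^ (L - e c)`. The matrices left from
`matV` after deleting a column are of this form, and the family is closed (up to linear
combinations) under the derivations `X_i ∂/∂X_i`. -/
noncomputable def binomMatrix {ι : Type*} (L : ℕ) (b : ι → σ) (e n : ι → ℕ) :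
    Matrix ι ι (MvPolynomial σ ℤ) :=
  Matrix.of fun r c => ((n r).choose (e c) : MvPolynomial σ ℤ) * X (b r) ^ (L - e c)

theorem X_mul_pderiv_choose_mul_X_pow (i : σ) {L h : ℕ} (hL : h ≤ L) (n : ℕ) :
    X i * pderiv i ((n.choose h : MvPolynomial σ ℤ) * X i ^ (L - h))
      = ((L : MvPolynomial σ ℤ) - (n : MvPolynomial σ ℤ)) *
          ((n.choose h : MvPolynomial σ ℤ) * X i ^ (L - h))
        + (n : MvPolynomial σ ℤ) * (((n - 1).choose h : MvPolynomial σ ℤ) * X i ^ (L - h)) := by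
  have h1 : X i * pderiv i ((n.choose h : MvPolynomial σ ℤ) * X i ^ (L - h))
      = ((L : MvPolynomial σ ℤ) - (h : MvPolynomial σ ℤ)) *
          ((n.choose h : MvPolynomial σ ℤ) * X i ^ (L - h)) := by
    rw [pderiv_mul, pderiv_pow, pderiv_X_self, ← Nat.cast_sub hL]
    have : pderiv i ((n.choose h : MvPolynomial σ ℤ)) = 0 := Derivation.map_natCast _ _
    rw [this]
    rcases Nat.eq_zero_or_pos (L - h) with h0 | h0
    · simp [h0]
    · obtain ⟨t, ht⟩ := Nat.exists_eq_succ_of_ne_zero h0.ne'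
      rw [ht]
      simp only [Nat.succ_eq_add_one, Nat.add_sub_cancel]
      ring
  have h2 : ((n : ℤ) - h) * n.choose h = n * (n - 1).choose h := by
    rcases n with _ | n
    · rcases h with _ | h <;> simp
    · rcases le_or_gt h (n + 1) with hh | hh
      · have := Nat.choose_mul_succ_eq n h
        zify [hh] at this
        push_cast
        linarith
      · rw [Nat.choose_eq_zero_of_lt hh, Nat.choose_eq_zero_of_lt (by omega : n + 1 - 1 < h)]
        simp
  have h3 : ((n : MvPolynomial σ ℤ) - h) * n.choose h = n * (n - 1).choose h := by
    have := congrArg (Int.cast : ℤ → MvPolynomial σ ℤ) h2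
    push_cast at this
    exact this
  rw [h1]
  linear_combination (X i ^ (L - h)) * h3

theorem X_mul_pderiv_det_binomMatrix [DecidableEq σ] {ι : Type*} [Fintype ι] [DecidableEq ι]
    {L : ℕ} (b : ι → σ) (e n : ι → ℕ) (he : ∀ c, e c ≤ L) (i : σ) :
    X i * pderiv i (binomMatrix L b e n).det = ∑ r with b r = i,
      (((L : MvPolynomial σ ℤ) - (n r : MvPolynomial σ ℤ)) * (binomMatrix L b e n).det
        + (n r : MvPolynomial σ ℤ) * (binomMatrix L b e (Function.update n r (n r - 1))).det) := by
  rw [derivation_det, Finset.mul_sum, Finset.sum_filter]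
  refine Finset.sum_congr rfl fun r _ => ?_
  rw [← Matrix.det_updateRow_smul]
  split_ifs with hr
  · have h : ((X i : MvPolynomial σ ℤ) • fun c => pderiv i (binomMatrix L b e n r c))
        = ((L : MvPolynomial σ ℤ) - (n r : MvPolynomial σ ℤ)) • (binomMatrix L b e n r)
          + (n r : MvPolynomial σ ℤ) • binomMatrix L b e (Function.update n r (n r - 1)) r := by
      funext c
      subst hr
      simpa [binomMatrix] using X_mul_pderiv_choose_mul_X_pow (b r) (he c) (n r)
    have h' : (binomMatrix L b e n).updateRow r
        (binomMatrix L b e (Function.update n r (n r - 1)) r)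
          = binomMatrix L b e (Function.update n r (n r - 1)) := by
      ext1 k c
      by_cases hk : k = r
      · subst hk; simp
      · simp [hk, binomMatrix]
    rw [h, Matrix.det_updateRow_add, Matrix.det_updateRow_smul, Matrix.det_updateRow_smul, h',
      Matrix.updateRow_eq_self]
  · refine Matrix.det_eq_zero_of_row_eq_zero r fun c => ?_
    simp [binomMatrix, pderiv_X_of_ne hr]

/-- Two rows with the same upper index `n`, belonging to `X i` and `X j`, agree modulo
`X i - X j`. -/
theorem X_sub_X_dvd_det_binomMatrix {ι : Type*} [Fintype ι] [DecidableEq ι] (L : ℕ)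
    (b : ι → σ) (e n : ι → ℕ) {r r' : ι} (hr : r ≠ r') (hn : n r = n r') :
    (X (b r) - X (b r') : MvPolynomial σ ℤ) ∣ (binomMatrix L b e n).det := by
  rw [← Ideal.mem_span_singleton, ← Ideal.Quotient.eq_zero_iff_mem, RingHom.map_det]
  have hX : Ideal.Quotient.mk (Ideal.span {(X (b r) - X (b r') : MvPolynomial σ ℤ)}) (X (b r))
      = Ideal.Quotient.mk _ (X (b r')) :=
    Ideal.Quotient.eq.2 (Ideal.mem_span_singleton_self _)
  refine Matrix.det_zero_of_row_eq hr ?_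
  funext c
  simp [binomMatrix, hn, hX]

/-- Let the rows of the block `j` include all upper indices `L + 1, …, L + q`, and let those of the
block `i`, with `p` rows, be at most `L + q`. The derivation `X_i ∂/∂X_i` lowers at most one upper
index of the block `i`, by one. The determinant vanishes modulo `X i - X j` unless the upper indices
of this block are distinct and at most `L`, and then their sum is at most `p * L - binom p 2`. Hence
the multiplicity of `X i - X j` is at least the excess of their sum over this bound. -/
theorem pow_dvd_det_binomMatrix [DecidableEq σ] {ι : Type*} [Fintype ι] [DecidableEq ι]
    {L q : ℕ} {b : ι → σ} {e : ι → ℕ} (he : ∀ c, e c ≤ L) {i j : σ} (hij : i ≠ j) (s : ℕ)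
    (n : ι → ℕ) (hi : ∀ r, b r = i → n r ≤ L + q)
    (hj : ∀ k, L < k → k ≤ L + q → ∃ r, b r = j ∧ n r = k)
    (hs : (Finset.univ.filter fun r => b r = i).card * L + s
      ≤ (∑ r with b r = i, n r) + (Finset.univ.filter fun r => b r = i).card.choose 2) :
    (X i - X j : MvPolynomial σ ℤ) ^ s ∣ (binomMatrix L b e n).det := by
  induction s generalizing n with
  | zero => simp
  | succ s ih =>
    rcases Nat.eq_zero_or_pos s with rfl | hs0
    · rw [zero_add, pow_one]
      by_cases hlarge : ∃ r, b r = i ∧ L < n r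
      · obtain ⟨r, hr, hL⟩ := hlarge
        obtain ⟨r', hr', hn⟩ := hj _ hL (hi r hr)
        have hne : r ≠ r' := fun h => hij (by rw [← hr, ← hr', h])
        have := X_sub_X_dvd_det_binomMatrix L b e n hne hn.symm
        rwa [hr, hr'] at this
      · push Not at hlarge
        by_cases hinj : Set.InjOn n (Finset.univ.filter fun r => b r = i : Finset ι)
        · exfalso
          have h1 := card_choose_two_le_sum_of_injOn (Finset.univ.filter fun r => b r = i)
            (fun r => L - n r) (fun x hx y hy hxy => hinj hx hy (by
              have h1 := hlarge x (by simpa using hx)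
              have h2 := hlarge y (by simpa using hy)
              dsimp only at hxy
              omega))
          have h2 : (∑ r with b r = i, (L - n r)) + ∑ r with b r = i, n r
              = (Finset.univ.filter fun r => b r = i).card * L := by
            rw [← Finset.sum_add_distrib, Finset.sum_congr rfl (g := fun _ => L), Finset.sum_const,
              smul_eq_mul]
            intro r hr
            exact Nat.sub_add_cancel (hlarge r (by simpa using hr))
          omega
        · simp only [Set.InjOn, not_forall] at hinj
          obtain ⟨r, hr, r', hr', hn, hne⟩ := hinj
          have hr : b r = i := by simpa using hr
          have hr' : b r' = i := by simpa using hr'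
          rw [Matrix.det_zero_of_row_eq hne]
          · exact dvd_zero _
          · funext c
            simp [binomMatrix, hn, hr, hr']
    · refine pow_succ_dvd_of_pderiv hij hs0.ne' (ih n hi hj (by omega)) ?_
      rw [X_mul_pderiv_det_binomMatrix b e n he]
      refine Finset.dvd_sum fun r hr => dvd_add (Dvd.dvd.mul_left (ih n hi hj (by omega)) _) ?_
      have hr' : b r = i := by simpa using hr
      rcases Nat.eq_zero_or_pos (n r) with h0 | h0
      · simp [h0]
      · refine Dvd.dvd.mul_left (ih _ (fun r₁ h₁ => ?_) (fun k hk hk' => ?_) ?_) _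
        · by_cases h : r₁ = r
          · subst h
            rw [Function.update_self]
            exact (Nat.sub_le _ _).trans (hi _ h₁)
          · rw [Function.update_of_ne h]
            exact hi _ h₁
        · obtain ⟨r₁, h₁, h₂⟩ := hj k hk hk'
          refine ⟨r₁, h₁, ?_⟩
          rwa [Function.update_of_ne]
          rintro rfl
          exact hij (hr'.symm.trans h₁)
        · have h1 := Finset.sum_update_of_mem hr n (n r - 1)
          have h2 := Finset.sum_sdiff (f := n) (Finset.singleton_subset_iff.2 hr)
          rw [Finset.sum_singleton] at h2
          omega

/-- Each term of the Leibniz expansion picks distinct exponents of `X i` from the rows of the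
block `i`. -/
theorem X_pow_dvd_det_binomMatrix [DecidableEq σ] {ι : Type*} [Fintype ι] [DecidableEq ι]
    {L : ℕ} (b : ι → σ) (e n : ι → ℕ) (he : ∀ c, e c ≤ L) (he' : Function.Injective e) (i : σ) :
    (X i : MvPolynomial σ ℤ) ^ (Finset.univ.filter fun r => b r = i).card.choose 2 ∣
      (binomMatrix L b e n).det := by
  rw [← Matrix.det_transpose, Matrix.det_apply]
  refine Finset.dvd_sum fun π _ => ?_
  rw [Units.smul_def, zsmul_eq_mul]
  refine Dvd.dvd.mul_left ?_ _
  refine dvd_trans ?_ (Finset.prod_dvd_prod_of_subset _ _ _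
    (Finset.subset_univ (Finset.univ.filter fun r => b r = i)))
  have : ∀ r ∈ Finset.univ.filter (fun r => b r = i), (binomMatrix L b e n).transpose (π r) r
      = ((n r).choose (e (π r)) : MvPolynomial σ ℤ) * X i ^ (L - e (π r)) := fun r hr => by
    have : b r = i := by simpa using hr
    simp [binomMatrix, this]
  rw [Finset.prod_congr rfl this, Finset.prod_mul_distrib, Finset.prod_pow_eq_pow_sum]
  refine Dvd.dvd.mul_left (pow_dvd_pow _ ?_) _
  refine card_choose_two_le_sum_of_injOn _ _ fun x _ y _ hxy => π.injective (he' ?_)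
  have h1 := he (π x)
  have h2 := he (π y)
  omega

end HermiteThue

namespace HermiteThue
open MvPolynomial

/-! ### The common factor of the minors -/

/-- Distinct linear forms among the `X i - X j` with `i < j` are not associated: a variable that
occurs in only one of the two forms separates them. -/
theorem X_sub_X_not_dvd_X_sub_X {σ : Type*} [LinearOrder σ] {i j i' j' : σ} (h : i < j)
    (h' : i' < j') (hne : (i, j) ≠ (i', j')) :
    ¬ (X i - X j : MvPolynomial σ ℤ) ∣ X i' - X j' := by
  have : ∃ a, a ≠ i ∧ a ≠ j ∧ (a = i' ∨ a = j') := by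
    by_contra! hc
    apply hne
    have h1 : i' = i ∨ i' = j := by
      by_contra! h1
      exact (hc i' h1.1 h1.2).1 rfl
    have h2 : j' = i ∨ j' = j := by
      by_contra! h2
      exact (hc j' h2.1 h2.2).2 rfl
    grind
  obtain ⟨a, h1, h2, h3⟩ := this
  refine not_dvd_of_eval (fun k => if k = a then 1 else 0) (by simp [h1.symm, h2.symm]) ?_
  rcases h3 with rfl | rfl
  · simp [h'.ne']
  · simp [h'.ne]

variable {m : ℕ} (l : Fin m → ℕ)

theorem factorT_eq : factorT l = (∏ j, X j ^ (l j).choose 2) *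
    ∏ p ∈ (Finset.univ : Finset (Fin m)).sigma (fun i => Finset.Ioi i),
      (X p.1 - X p.2 : MvPolynomial (Fin m) ℤ) ^ min (l p.1 ^ 2) (l p.2 ^ 2) := by
  rw [factorT, Finset.prod_sigma]

theorem factorT_ne_zero : factorT l ≠ 0 := by
  rw [factorT_eq]
  refine mul_ne_zero (Finset.prod_ne_zero_iff.2 fun j _ => pow_ne_zero _ (X_ne_zero j))
    (Finset.prod_ne_zero_iff.2 fun p hp => pow_ne_zero _ (prime_X_sub_X ?_).ne_zero)
  exact (Finset.mem_Ioi.1 (Finset.mem_sigma.1 hp).2).ne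

/-- The factors of `factorT` are powers of pairwise non-associated primes, so divisibility can be
checked for each of them separately. -/
theorem factorT_dvd {D : MvPolynomial (Fin m) ℤ} (h : ∀ j, X j ^ (l j).choose 2 ∣ D)
    (h' : ∀ i j, i < j → (X i - X j) ^ min (l i ^ 2) (l j ^ 2) ∣ D) : factorT l ∣ D := by
  rw [factorT_eq]
  refine IsRelPrime.mul_dvd ?_ ?_ ?_
  · refine IsRelPrime.prod_left fun k _ => IsRelPrime.prod_right fun p hp => IsRelPrime.pow ?_
    have hp' : p.1 < p.2 := Finset.mem_Ioi.1 (Finset.mem_sigma.1 hp).2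
    exact ((prime_X_sub_X hp'.ne).irreducible.isRelPrime_iff_not_dvd.2
      (X_sub_X_not_dvd_X _ _ _)).symm
  · refine Fintype.prod_dvd_of_isRelPrime (fun i j hij => IsRelPrime.pow ?_) h
    refine (X_prime (i := i)).irreducible.isRelPrime_iff_not_dvd.2 ?_
    exact not_dvd_of_eval (fun k => if k = i then 0 else 1) (by simp) (by simp [hij.symm])
  · refine Finset.prod_dvd_of_isRelPrime (fun p hp p' hp' hne => IsRelPrime.pow ?_) fun p hp =>
      h' _ _ (Finset.mem_Ioi.1 (Finset.mem_sigma.1 hp).2)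
    have h1 : p.1 < p.2 := Finset.mem_Ioi.1 (Finset.mem_sigma.1 hp).2
    have h2 : p'.1 < p'.2 := Finset.mem_Ioi.1 (Finset.mem_sigma.1 hp').2
    refine (prime_X_sub_X h1.ne).irreducible.isRelPrime_iff_not_dvd.2
      (X_sub_X_not_dvd_X_sub_X h1 h2 fun h => hne ?_)
    obtain ⟨a, b⟩ := p
    obtain ⟨a', b'⟩ := p'
    simp only [Prod.mk.injEq] at h
    obtain ⟨rfl, rfl⟩ := h
    rfl

/-- The block of a row of `matV`. -/
def blockOf (r : Fin (total l)) : Fin m := (finSigmaFinEquiv.symm r).1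

/-- The upper index of the binomial coefficients in a row of `matV`. -/
def upperIndex (r : Fin (total l)) : ℕ := total l + (finSigmaFinEquiv.symm r).2 + 1

theorem blockOf_finSigmaFinEquiv (j : Fin m) (k : Fin (l j)) :
    blockOf l (finSigmaFinEquiv ⟨j, k⟩) = j := by
  rw [blockOf, Equiv.symm_apply_apply]

theorem upperIndex_finSigmaFinEquiv (j : Fin m) (k : Fin (l j)) :
    upperIndex l (finSigmaFinEquiv ⟨j, k⟩) = total l + k + 1 := by
  rw [upperIndex, Equiv.symm_apply_apply]

theorem matV_apply (r : Fin (total l)) (h : Fin (total l + 1)) :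
    matV l r h = ((upperIndex l r).choose h : MvPolynomial (Fin m) ℤ) *
      X (blockOf l r) ^ (total l - (h : ℕ)) := rfl

theorem minorV_eq (i : Fin (total l + 1)) :
    minorV l i = (binomMatrix (total l) (blockOf l) (fun c => (i.succAbove c : ℕ))
      (upperIndex l)).det := rfl

theorem sum_blockOf_eq (f : Fin (total l) → ℕ) (j : Fin m) :
    ∑ r with blockOf l r = j, f r = ∑ k : Fin (l j), f (finSigmaFinEquiv ⟨j, k⟩) := by
  rw [Finset.sum_filter, ← Equiv.sum_comp finSigmaFinEquiv, Fintype.sum_sigma,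
    Fintype.sum_eq_single j]
  · simp [blockOf_finSigmaFinEquiv]
  · intro i hi
    simp [blockOf_finSigmaFinEquiv, hi]

theorem card_blockOf_eq (j : Fin m) :
    (Finset.univ.filter fun r => blockOf l r = j).card = l j := by
  rw [Finset.card_eq_sum_ones, sum_blockOf_eq]
  simp

/-- The sum of the upper indices of the block `j` exceeds the bound in `pow_dvd_det_binomMatrix`
by exactly `l j ^ 2`. -/
theorem sum_upperIndex_add (j : Fin m) :
    (∑ r with blockOf l r = j, upperIndex l r) + (l j).choose 2 = l j * total l + l j ^ 2 := by
  rw [sum_blockOf_eq]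
  simp only [upperIndex_finSigmaFinEquiv]
  rw [Fin.sum_univ_eq_sum_range fun k => total l + k + 1]
  generalize total l = L
  induction l j with
  | zero => simp
  | succ n ih =>
    rw [Finset.sum_range_succ, Nat.choose_succ_succ' _ 1, Nat.choose_one_right]
    nlinarith

theorem pow_dvd_minorV_of_le (c : Fin (total l + 1)) {i j : Fin m} (hij : i ≠ j)
    (h : l i ≤ l j) : (X i - X j : MvPolynomial (Fin m) ℤ) ^ (l i ^ 2) ∣ minorV l c := by
  rw [minorV_eq]
  refine pow_dvd_det_binomMatrix (q := l j) (fun c => Nat.lt_succ_iff.1 (Fin.is_lt _)) hij _ _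
    (fun r hr => ?_) (fun k hk hk' => ?_) ?_
  · have h1 := (finSigmaFinEquiv.symm r).2.is_lt
    have h2 : l (finSigmaFinEquiv.symm r).1 = l i := congrArg l hr
    simp only [upperIndex]
    omega
  · refine ⟨finSigmaFinEquiv ⟨j, ⟨k - total l - 1, by omega⟩⟩, blockOf_finSigmaFinEquiv l _ _, ?_⟩
    simp only [upperIndex_finSigmaFinEquiv]
    omega
  · rw [card_blockOf_eq, sum_upperIndex_add]

theorem factorT_dvd_minorV (c : Fin (total l + 1)) : factorT l ∣ minorV l c := by
  refine factorT_dvd l (fun j => ?_) fun i j hij => ?_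
  · have := X_pow_dvd_det_binomMatrix (L := total l) (blockOf l) (fun k => (c.succAbove k : ℕ))
      (upperIndex l) (fun c => Nat.lt_succ_iff.1 (Fin.is_lt _))
      (fun a b hab => Fin.succAbove_right_injective (Fin.ext hab)) j
    rwa [card_blockOf_eq] at this
  · rcases le_total (l i) (l j) with h | h
    · rw [min_eq_left (Nat.pow_le_pow_left h 2)]
      exact pow_dvd_minorV_of_le l c hij.ne h
    · rw [min_eq_right (Nat.pow_le_pow_left h 2), ← neg_sub (X j), neg_pow]
      exact (IsUnit.mul_left_dvd ((isUnit_one.neg).pow _)).2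
        (pow_dvd_minorV_of_le l c hij.ne' h)

end HermiteThue

namespace HermiteThue
open Polynomial

/-! ### Non-vanishing of a minor -/

/-- The lowest power of the variable in the determinant of the matrix `A r c * X ^ (b r * (N - c))`
with `b` monotone comes from the permutations that preserve the blocks, i.e. the level sets of `b`:
by the rearrangement inequality `∑ b (π c) * c` is largest for these. Hence the lowest coefficient
is the determinant of the block diagonal part of `A`. -/
theorem det_ne_zero_of_blockDiagonal {N : ℕ} {b : Fin N → ℕ} (hb : Monotone b)
    (A : Matrix (Fin N) (Fin N) ℤ)
    (hA : (Matrix.of fun r c => if b r = b c then A r c else 0).det ≠ 0) :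
    (Matrix.of fun r c => C (A r c) * X ^ (b r * (N - c)) : Matrix (Fin N) (Fin N) ℤ[X]).det
      ≠ 0 := by
  have hmono : Monovary b fun c : Fin N => (c : ℕ) := fun i j hij => hb (Fin.le_def.2 hij.le)
  have hsum : ∀ π : Equiv.Perm (Fin N),
      (∑ c, b (π c) * (N - c)) + ∑ c, b (π c) * c = (∑ c, b c) * N := fun π => by
    rw [← Finset.sum_add_distrib, ← Equiv.sum_comp π b, Finset.sum_mul]
    refine Finset.sum_congr rfl fun c _ => ?_
    rw [← mul_add, Nat.sub_add_cancel c.is_lt.le]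
  have hiff : ∀ π : Equiv.Perm (Fin N),
      ∑ c, b (π c) * (N - c) = ∑ c, b c * (N - c) ↔ ∀ c, b (π c) = b c := fun π => by
    have h1 := hsum π
    have h2 := hsum 1
    simp only [Equiv.Perm.one_apply] at h2
    have h3 : ∑ c, b (π c) * (N - c) = ∑ c, b c * (N - c) ↔
        ∑ c, b (π c) * c = ∑ c, b c * c := by omega
    rw [h3, hmono.sum_comp_perm_mul_eq_sum_mul_iff]
    constructor
    · intro h c
      have hm : Monotone (b ∘ π) := fun i j hij => by
        rcases hij.lt_or_eq with hij | rfl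
        · exact h (Fin.lt_def.1 hij)
        · exact le_rfl
      exact congrFun (Tuple.unique_monotone (σ := π) (τ := 1) hm hb) c
    · intro h i j hij
      simp only [Function.comp_apply, h]
      exact hmono hij
  have hcoeff : (Matrix.of fun r c => C (A r c) * X ^ (b r * (N - c)) :
      Matrix (Fin N) (Fin N) ℤ[X]).det.coeff (∑ c, b c * (N - c))
        = (Matrix.of fun r c => if b r = b c then A r c else 0).det := by
    rw [Matrix.det_apply, Matrix.det_apply, finsetSum_coeff]
    refine Finset.sum_congr rfl fun π _ => ?_
    rw [Units.smul_def, Units.smul_def, coeff_smul]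
    congr 1
    simp only [Matrix.of_apply]
    rw [Finset.prod_mul_distrib, Finset.prod_pow_eq_pow_sum, ← map_prod, coeff_C_mul, coeff_X_pow]
    by_cases h : ∀ c, b (π c) = b c
    · rw [if_pos ((hiff π).2 h).symm, mul_one]
      exact Finset.prod_congr rfl fun c _ => by rw [if_pos (h c)]
    · rw [if_neg fun h' => h ((hiff π).1 h'.symm), mul_zero]
      push Not at h
      obtain ⟨c, hc⟩ := h
      exact (Finset.prod_eq_zero (Finset.mem_univ c) (if_neg hc)).symm
  intro h
  rw [h, coeff_zero] at hcoeff
  exact hA hcoeff.symm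

/-- The block diagonal part of a matrix of binomial coefficients is regular. If `x ≠ 0` is in the
kernel and `c₀` is the last index with `x c₀ ≠ 0`, then the polynomial `∑ x c * binom z c`, with the
sum over the block of `c₀`, has degree `c₀`. It has too many zeros: the numbers `r` for the
rows `r` before the block, and the `n r` for the rows `r ≤ c₀` of the block. -/
theorem det_blockDiagonal_choose_ne_zero {N : ℕ} {b n : Fin N → ℕ} (hb : Monotone b)
    (hn : ∀ r, N ≤ n r) (hinj : ∀ r r', b r = b r' → n r = n r' → r = r') :
    (Matrix.of fun r c => if b r = b c then ((n r).choose c : ℤ) else 0 :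
      Matrix (Fin N) (Fin N) ℤ).det ≠ 0 := by
  intro hdet
  have hdet' : ((Matrix.of fun r c => if b r = b c then ((n r).choose c : ℤ) else 0 :
      Matrix (Fin N) (Fin N) ℤ).map (Int.castRingHom ℚ)).det = 0 := by
    rw [← RingHom.mapMatrix_apply, ← RingHom.map_det, hdet, map_zero]
  obtain ⟨x, hx, hx0⟩ := Matrix.exists_mulVec_eq_zero_iff.2 hdet'
  obtain ⟨c₁, hc₁⟩ := Function.ne_iff.1 hx
  obtain ⟨c₀, hc₀, hmax⟩ := (Finset.univ.filter fun c => x c ≠ 0).exists_max_image id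
    ⟨c₁, by simpa using hc₁⟩
  replace hc₀ : x c₀ ≠ 0 := by simpa using hc₀
  replace hmax : ∀ c, x c ≠ 0 → c ≤ c₀ := fun c hc => hmax c (by simpa using hc)
  set P : ℚ[X] := ∑ c with b c = b c₀, C (x c / (c : ℕ).factorial) * descPochhammer ℚ c with hP
  have heval : ∀ k : ℕ, P.eval (k : ℚ) = ∑ c with b c = b c₀, x c * k.choose c := fun k => by
    rw [hP, eval_finsetSum]
    refine Finset.sum_congr rfl fun c _ => ?_
    rw [eval_mul, eval_C, descPochhammer_eval_eq_descFactorial,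
      Nat.descFactorial_eq_factorial_mul_choose]
    push_cast
    field_simp
  have hroot₁ : ∀ r, b r = b c₀ → P.eval (n r : ℚ) = 0 := fun r hr => by
    have := congrFun hx0 r
    rw [heval, Finset.sum_filter]
    simpa [Matrix.mulVec, dotProduct, hr, eq_comm, mul_comm] using this
  have hroot₂ : ∀ r, b r < b c₀ → P.eval ((r : ℕ) : ℚ) = 0 := fun r hr => by
    rw [heval]
    refine Finset.sum_eq_zero fun c hc => ?_
    have hrc : r < c := by
      by_contra! h
      exact absurd (hb h) (by rw [(Finset.mem_filter.1 hc).2]; omega)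
    rw [Nat.choose_eq_zero_of_lt hrc, Nat.cast_zero, mul_zero]
  have hdeg : P.natDegree ≤ c₀ := by
    refine natDegree_sum_le_of_forall_le _ _ fun c _ => ?_
    by_cases hc : x c = 0
    · simp [hc]
    · exact (natDegree_C_mul_le _ _).trans ((descPochhammer_natDegree ℚ _).trans_le (hmax c hc))
  have hcoeff : P.coeff c₀ = x c₀ / (c₀ : ℕ).factorial := by
    rw [hP, finsetSum_coeff, Finset.sum_eq_single_of_mem c₀ (by simp)]
    · have := (monic_descPochhammer ℚ (c₀ : ℕ)).coeff_natDegree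
      rw [descPochhammer_natDegree] at this
      rw [coeff_C_mul, this, mul_one]
    · intro c _ hne
      by_cases hc : x c = 0
      · simp [hc]
      · rw [coeff_C_mul, coeff_eq_zero_of_natDegree_lt, mul_zero]
        rw [descPochhammer_natDegree]
        exact lt_of_le_of_ne (hmax c hc) (Fin.val_ne_of_ne hne)
  have hP0 : P = 0 := by
    refine eq_zero_of_natDegree_lt_card_of_eval_eq_zero' P
      ((Finset.Iic c₀).image fun r => ((if b r < b c₀ then (r : ℕ) else n r : ℕ) : ℚ)) ?_ ?_
    · intro y hy
      obtain ⟨r, hr, rfl⟩ := Finset.mem_image.1 hy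
      split_ifs with h
      · exact hroot₂ r h
      · exact hroot₁ r (le_antisymm (hb (Finset.mem_Iic.1 hr)) (not_lt.1 h))
    · rw [Finset.card_image_of_injOn, Fin.card_Iic]
      · omega
      · intro r hr r' hr' h
        have h1 := hb (Finset.mem_Iic.1 hr)
        have h2 := hb (Finset.mem_Iic.1 hr')
        have h3 := hn r
        have h4 := hn r'
        have h5 := r.is_lt
        have h6 := r'.is_lt
        have h : (if b r < b c₀ then (r : ℕ) else n r) = if b r' < b c₀ then (r' : ℕ) else n r' := by
          exact Nat.cast_injective (R := ℚ) h
        split_ifs at h with h7 h8 h8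
        · exact Fin.ext h
        · omega
        · omega
        · exact hinj r r' (by omega) h
  rw [hP0, coeff_zero] at hcoeff
  exact hc₀ ((div_eq_zero_iff.1 hcoeff.symm).resolve_right (by positivity))

variable {m : ℕ} (l : Fin m → ℕ)

theorem blockOf_mono : Monotone (blockOf l) := by
  intro r r' hrr
  obtain ⟨⟨j, k⟩, rfl⟩ := finSigmaFinEquiv.surjective r
  obtain ⟨⟨j', k'⟩, rfl⟩ := finSigmaFinEquiv.surjective r'
  simp only [blockOf_finSigmaFinEquiv]
  by_contra! h
  rw [Fin.le_def, finSigmaFinEquiv_apply, finSigmaFinEquiv_apply] at hrr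
  simp only at hrr
  set f : ℕ → ℕ := fun i => if hi : i < m then l ⟨i, hi⟩ else 0 with hf
  have hs : ∀ j : Fin m, ∑ i : Fin j, l (Fin.castLE j.2.le i) = ∑ i ∈ Finset.range j, f i :=
    fun j => by
      rw [← Fin.sum_univ_eq_sum_range]
      refine Finset.sum_congr rfl fun i _ => ?_
      rw [hf]
      dsimp only
      rw [dif_pos (i.2.trans j.2)]
      rfl
  rw [hs, hs] at hrr
  have h1 : ∑ i ∈ Finset.range (j' + 1), f i ≤ ∑ i ∈ Finset.range j, f i :=
    Finset.sum_le_sum_of_subset (Finset.range_subset_range.2 h)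
  have h2 : f j' = l j' := by simp [hf]
  rw [Finset.sum_range_succ, h2] at h1
  have := k'.2
  omega

theorem minorV_last_ne_zero : minorV l (Fin.last _) ≠ 0 := by
  intro h
  have hb : Monotone fun r => (blockOf l r : ℕ) := fun _ _ h => Fin.le_def.1 (blockOf_mono l h)
  refine det_ne_zero_of_blockDiagonal hb
    (Matrix.of fun r c => ((upperIndex l r).choose c : ℤ))
    (det_blockDiagonal_choose_ne_zero hb (n := upperIndex l)
      (fun r => by unfold upperIndex; omega) fun r r' h1 h2 => ?_) ?_
  · obtain ⟨⟨j, k⟩, rfl⟩ := finSigmaFinEquiv.surjective r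
    obtain ⟨⟨j', k'⟩, rfl⟩ := finSigmaFinEquiv.surjective r'
    simp only [blockOf_finSigmaFinEquiv, upperIndex_finSigmaFinEquiv] at h1 h2
    obtain rfl : j = j' := Fin.ext h1
    obtain rfl : k = k' := Fin.ext (by omega)
    rfl
  · have := congrArg (MvPolynomial.aeval fun j : Fin m => (X ^ (j : ℕ) : ℤ[X])) h
    rw [minorV_eq, map_zero, AlgHom.map_det] at this
    rw [← this]
    congr 1
    ext1 r c
    simp [binomMatrix, pow_mul]

end HermiteThue

namespace HermiteThue

/-! ### The remainders -/

/-- An exponential `e^{a t}` with `a ≠ 0` is not a rational function: from `P * e^{a t} = Q` one gets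
`(P' + a P) * Q = P * Q'`, where the left side has the larger degree. -/
theorem mul_rescale_exp_ne {R : Type*} [CommRing R] [IsDomain R] [Algebra ℚ R] {a : R}
    (ha : a ≠ 0) {P : Polynomial R} (hP : P ≠ 0) (Q : Polynomial R) :
    (P : PowerSeries R) * PowerSeries.rescale a (PowerSeries.exp R) ≠ Q := by
  intro h
  set E := PowerSeries.rescale a (PowerSeries.exp R) with hE
  have hE' : PowerSeries.derivative R E = PowerSeries.C a * E := by
    conv_rhs => rw [hE, ← PowerSeries.derivative_exp]
    ext n
    rw [hE, PowerSeries.coeff_derivative, PowerSeries.coeff_C_mul, PowerSeries.coeff_rescale,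
      PowerSeries.coeff_rescale, PowerSeries.coeff_derivative]
    ring
  have hE0 : E ≠ 0 := fun h0 => by
    have := congrArg (PowerSeries.coeff 0) h0
    simp [hE, PowerSeries.coeff_rescale, PowerSeries.coeff_exp] at this
  have hQ : Q ≠ 0 := by
    rintro rfl
    rw [Polynomial.coe_zero, mul_eq_zero] at h
    exact h.elim (fun h => hP (Polynomial.coe_eq_zero_iff.1 h)) hE0
  have hd := congrArg (PowerSeries.derivative R) h
  rw [Derivation.leibniz, hE', PowerSeries.derivative_coe, PowerSeries.derivative_coe, smul_eq_mul,
    smul_eq_mul] at hd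
  have hpol : (Polynomial.C a * P + Polynomial.derivative P) * Q
      = P * Polynomial.derivative Q := by
    apply Polynomial.coe_injective
    push_cast
    rw [← hd, ← h]
    ring
  have h1 : (Polynomial.C a * P + Polynomial.derivative P).degree = P.degree := by
    rw [Polynomial.degree_add_eq_left_of_degree_lt, Polynomial.degree_C_mul ha]
    rw [Polynomial.degree_C_mul ha]
    exact Polynomial.degree_derivative_lt hP
  have h2 := congrArg Polynomial.degree hpol
  rw [Polynomial.degree_mul, Polynomial.degree_mul, h1] at h2
  have h3 := WithBot.add_left_cancel (Polynomial.degree_ne_bot.2 hP) h2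
  exact (Polynomial.degree_derivative_lt hQ).ne' h3

variable {m : ℕ} (l : Fin m → ℕ)

/-- Laplace expansion of the determinant of `matV` with one of its rows repeated. -/
theorem sum_matV_mul_minorV (r : Fin (total l)) :
    ∑ i, matV l r i * ((-1) ^ (i : ℕ) * minorV l i) = 0 := by
  set A : Matrix (Fin (total l + 1)) (Fin (total l + 1)) (MvPolynomial (Fin m) ℤ) :=
    Fin.cons (matV l r) (matV l)
  have h : A.det = 0 := Matrix.det_zero_of_row_eq (Fin.succ_ne_zero r).symm rfl
  rw [Matrix.det_succ_row_zero] at h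
  rw [← h]
  refine Finset.sum_congr rfl fun i _ => ?_
  rw [show A 0 i = matV l r i from rfl,
    show (A.submatrix Fin.succ i.succAbove).det = minorV l i from rfl]
  ring

/-- Beyond the degree of the polynomial, the coefficients of `(∑ L!/i! a_i t^i) * e^{X_j t}` are the
values of linear forms in the `a_i` that occur as rows of `matV`. -/
theorem coeff_mul_expSeries (j : Fin m) {L n : ℕ} (hn : L ≤ n)
    (a : Fin (L + 1) → MvPolynomial (Fin m) ℚ) :
    PowerSeries.coeff n (((∑ i : Fin (L + 1), Polynomial.monomial (i : ℕ)
      (MvPolynomial.C ((L.factorial : ℚ) / ((i : ℕ).factorial : ℚ)) * a i) :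
        Polynomial (MvPolynomial (Fin m) ℚ)) : PowerSeries (MvPolynomial (Fin m) ℚ)) * expSeries j)
      = MvPolynomial.C ((L.factorial : ℚ) / (n.factorial : ℚ)) * MvPolynomial.X j ^ (n - L) *
        ∑ i : Fin (L + 1), ((n.choose (i : ℕ) : ℕ) : MvPolynomial (Fin m) ℚ) *
          MvPolynomial.X j ^ (L - (i : ℕ)) * a i := by
  rw [← Polynomial.coeToPowerSeries.ringHom_apply, map_sum, Finset.sum_mul, map_sum, Finset.mul_sum]
  refine Finset.sum_congr rfl fun i _ => ?_
  have hi : (i : ℕ) ≤ L := Nat.lt_succ_iff.1 i.is_lt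
  have hin := hi.trans hn
  rw [Polynomial.coeToPowerSeries.ringHom_apply, Polynomial.coe_monomial,
    PowerSeries.monomial_eq_C_mul_X_pow, mul_assoc, PowerSeries.coeff_C_mul,
    PowerSeries.coeff_X_pow_mul', if_pos hin, expSeries, PowerSeries.coeff_rescale,
    PowerSeries.coeff_exp, MvPolynomial.algebraMap_eq]
  have h1 : MvPolynomial.C ((L.factorial : ℚ) / ((i : ℕ).factorial : ℚ)) *
      MvPolynomial.C (1 / ((n - i).factorial : ℚ))
      = MvPolynomial.C ((L.factorial : ℚ) / (n.factorial : ℚ)) *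
        ((n.choose (i : ℕ) : ℕ) : MvPolynomial (Fin m) ℚ) := by
    rw [← map_natCast (MvPolynomial.C : ℚ →+* MvPolynomial (Fin m) ℚ), ← map_mul, ← map_mul,
      Nat.cast_choose ℚ hin]
    congr 1
    field_simp
  have h2 : (MvPolynomial.X j : MvPolynomial (Fin m) ℚ) ^ (n - i)
      = MvPolynomial.X j ^ (n - L) * MvPolynomial.X j ^ (L - i) := by
    rw [← pow_add]
    congr 1
    omega
  rw [h2]
  linear_combination (a i * MvPolynomial.X j ^ (n - L) * MvPolynomial.X j ^ (L - (i : ℕ))) * h1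

end HermiteThue

open HermiteThue in
theorem theorem2p2 (m : ℕ) (l : Fin m → ℕ) (hl : ∀ j, 0 < l j) :
    factorT l ≠ 0 ∧
    (∀ i, factorT l ∣ minorV l i) ∧
    ∃ (B : Fin (m + 1) → Polynomial (MvPolynomial (Fin m) ℚ))
      (S : Fin m → PowerSeries (MvPolynomial (Fin m) ℚ))
      (τ : Fin (total l + 1) → MvPolynomial (Fin m) ℤ),
      (∀ j, B j ≠ 0) ∧
      (∀ j : Fin m, (B 0 : PowerSeries (MvPolynomial (Fin m) ℚ)) * expSeries j
        - (B j.succ : PowerSeries (MvPolynomial (Fin m) ℚ)) = S j) ∧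
      (∀ j, (B j).natDegree ≤ total l) ∧
      (∀ j : Fin m, ((total l + l j + 1 : ℕ) : ℕ∞) ≤ (S j).order ∧ (S j).order < ⊤) ∧
      (∀ i, factorT l * τ i = (-1) ^ (i : ℕ) * minorV l i) ∧
      B 0 = ∑ i : Fin (total l + 1), Polynomial.monomial (i : ℕ)
        (MvPolynomial.C (((total l).factorial : ℚ) / ((i : ℕ).factorial : ℚ)) *
          MvPolynomial.map (Int.castRingHom ℚ) (τ i)) := by
  refine ⟨factorT_ne_zero l, factorT_dvd_minorV l, ?_⟩
  choose τ hτ using fun i : Fin (total l + 1) =>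
    (factorT_dvd_minorV l i).mul_left ((-1) ^ (i : ℕ))
  have hker : ∀ r, ∑ i, matV l r i * τ i = 0 := fun r => by
    have h := sum_matV_mul_minorV l r
    simp_rw [hτ, mul_left_comm _ (factorT l), ← Finset.mul_sum] at h
    exact (mul_eq_zero.1 h).resolve_left (factorT_ne_zero l)
  have hτ0 : τ (Fin.last _) ≠ 0 := fun h => by
    have h' := hτ (Fin.last _)
    rw [h, mul_zero, mul_eq_zero] at h'
    exact h'.elim (pow_ne_zero _ (neg_ne_zero.2 one_ne_zero)) (minorV_last_ne_zero l)
  set B₀ : Polynomial (MvPolynomial (Fin m) ℚ) := ∑ i : Fin (total l + 1),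
    Polynomial.monomial (i : ℕ) (MvPolynomial.C
      (((total l).factorial : ℚ) / ((i : ℕ).factorial : ℚ)) *
        MvPolynomial.map (Int.castRingHom ℚ) (τ i)) with hB₀
  have hB₀deg : B₀.natDegree ≤ total l := Polynomial.natDegree_sum_le_of_forall_le _ _ fun i _ =>
    (Polynomial.natDegree_monomial_le _).trans (Nat.lt_succ_iff.1 i.is_lt)
  have hB₀ne : B₀ ≠ 0 := fun h => by
    have hc := congrArg (fun p => Polynomial.coeff p (total l)) h
    simp only [hB₀, Polynomial.finsetSum_coeff, Polynomial.coeff_zero] at hc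
    rw [Finset.sum_eq_single_of_mem (Fin.last _) (Finset.mem_univ _), Fin.val_last,
      Polynomial.coeff_monomial_same, div_self (by positivity), map_one, one_mul] at hc
    · exact hτ0 (MvPolynomial.map_injective _ (Int.cast_injective (α := ℚ)) (by simpa using hc))
    · intro i _ hi
      exact Polynomial.coeff_monomial_of_ne _ fun h => hi (Fin.ext h.symm)
  have hunit : ∀ j : Fin m, IsUnit (expSeries j) := fun j =>
    (PowerSeries.isUnit_exp (MvPolynomial (Fin m) ℚ)).map (PowerSeries.rescale _)
  refine ⟨Fin.cons B₀ fun j => PowerSeries.trunc (total l + 1)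
    ((B₀ : PowerSeries (MvPolynomial (Fin m) ℚ)) * expSeries j),
    fun j => (B₀ : PowerSeries (MvPolynomial (Fin m) ℚ)) * expSeries j - (PowerSeries.trunc (total l + 1)
    ((B₀ : PowerSeries (MvPolynomial (Fin m) ℚ)) * expSeries j) :
      PowerSeries (MvPolynomial (Fin m) ℚ)), τ, ?_, fun j => by simp, ?_, fun j => ⟨?_, ?_⟩,
    fun i => (hτ i).symm, rfl⟩
  · refine Fin.cases hB₀ne fun j h => hB₀ne ?_
    rw [Fin.cons_succ] at h
    -- Otherwise the product, hence also `B₀`, has order larger than `L` in `t`.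
    have h1 : (PowerSeries.X : PowerSeries (MvPolynomial (Fin m) ℚ)) ^ (total l + 1) ∣
        (B₀ : PowerSeries (MvPolynomial (Fin m) ℚ)) * expSeries j :=
      PowerSeries.X_pow_dvd_iff.2 fun n hn => by
      have := congrArg (fun p => Polynomial.coeff p n) h
      simpa [PowerSeries.coeff_trunc, hn] using this
    rw [(hunit j).dvd_mul_right, PowerSeries.X_pow_dvd_iff] at h1
    ext1 n
    rcases lt_or_ge n (total l + 1) with hn | hn
    · simpa using h1 n hn
    · simpa using Polynomial.coeff_eq_zero_of_natDegree_lt (by omega : B₀.natDegree < n)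
  · refine Fin.cases hB₀deg fun j => ?_
    rw [Fin.cons_succ]
    exact Nat.lt_succ_iff.1 (PowerSeries.natDegree_trunc_lt _ _)
  · refine PowerSeries.nat_le_order _ _ fun n hn => ?_
    rw [map_sub, Polynomial.coeff_coe, PowerSeries.coeff_trunc]
    split_ifs with hn'
    · exact sub_self _
    · rw [sub_zero, hB₀, coeff_mul_expSeries j (by omega)]
      have h := congrArg (MvPolynomial.map (Int.castRingHom ℚ))
        (hker (finSigmaFinEquiv ⟨j, ⟨n - total l - 1, by omega⟩⟩))
      have hup := upperIndex_finSigmaFinEquiv l j ⟨n - total l - 1, by omega⟩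
      have hbl := blockOf_finSigmaFinEquiv l j ⟨n - total l - 1, by omega⟩
      rw [show total l + (n - total l - 1) + 1 = n by omega] at hup
      have hV : ∀ i, matV l (finSigmaFinEquiv ⟨j, ⟨n - total l - 1, by omega⟩⟩) i
          = ((n.choose (i : ℕ) : ℕ) : MvPolynomial (Fin m) ℤ) *
            MvPolynomial.X j ^ (total l - (i : ℕ)) := fun i => by
        rw [matV_apply, hup, hbl]
      simp_rw [hV] at h
      rw [map_sum, map_zero] at h
      simp only [map_mul, map_natCast, map_pow, MvPolynomial.map_X] at h
      rw [h, mul_zero]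
  · rw [lt_top_iff_ne_top, Ne, PowerSeries.order_eq_top, sub_eq_zero]
    exact mul_rescale_exp_ne (MvPolynomial.X_ne_zero j) hB₀ne _
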